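/- Notation. For a group $G$ and a $G$-set $\Omega$ let $J\Omega=\ker(\varepsilon:\mathbb Z\Omega\to\mathbb Z)$ be the kernel of the augmentation, and put $H_n(G,\Omega)=\operatorname{Tor}^{\mathbb ZG}_{n-1}(J\Omega,\mathbb Z)=H_{n-1}(G;J\Omega)$. Let $S_q(\Omega)$ be the abelian group generated by the $(q+1)$-tuples $\langle z_0,\dots,z_q\rangle$ of points of $\Omega$ modulo the relations $\langle z_0,\dots,z_q\rangle=\operatorname{sgn}(\tau)\langle z_{\tau(0)},\dots,z_{\tau(q)}\rangle$ for all permutations $\tau$, and $\langle z_0,\dots,z_q\rangle=0$ if the $z_i$ are not distinct, with boundary $\partial\langle z_0,\dots,z_q\rangle=\sum_i(-1)^i\langle z_0,\dots,\widehat{z_i},\dots,z_q\rangle$. Let $S_q(\Omega)_G$ be the result of adding the relations $\langle gz_0,\dots,gz_q\rangle=\langle z_0,\dots,z_q\rangle$ for $g\in G$. For non-empty $\Omega$ the sequence $\cdots\to S_2(\Omega)\to S_1(\Omega)\to J\Omega\to0$ is exact. A map over $\mathrm{id}_{J\Omega}$ from a free $\mathbb ZG$-resolution of $J\Omega$ to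 this resolution, unique up to homotopy, induces for $n\ge2$ a homomorphism $\mu:H_n(G,\Omega)\to H_n(S_\bullet(\Omega)_G)$. For $G=\operatorname{Isom}^+(\mathbb H^n)$ and $\Omega=\partial\mathbb H^n$ put $P_n=H_n\bigl(S_\bullet(\partial\mathbb H^n)_{\operatorname{Isom}^+(\mathbb H^n)}\bigr)$, so that $\mu:H_n(\operatorname{Isom}^+(\mathbb H^n),\partial\mathbb H^n)\to P_n$. Setting. Let $n\ge2$ and let $M$ be the interior of a compact connected oriented topological $n$-manifold $M_0$ with (possibly empty) boundary, such that the universal cover $\widetilde{M_0}$ and all boundary components of $\widetilde{M_0}$ are contractible. Let $\Gamma=\pi_1(M)=\pi_1(M_0)$, acting on $\widetilde{M_0}$ by covering transformations; let $\mathcal C$ be the $\Gamma$-set of boundary components of $\widetilde{M_0}$, and let $P_c\subseteq\Gamma$ be the stabilizer of $c\in\mathcal C$. Let $f:\Gamma\to\operatorname{Isom}^+(\mathbb H^n)$ be a homomorphism such that for each $c\in\mathcal C$ the group $f(P_c)$ fixes some point of $\partial\mathbb H^n$. For a map $h:\mathcal C\to\partial\mathbb H^n$ with $h(gc)=f(g)h(c)$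 for all $g\in\Gamma$, $c\in\mathcal C$, let $\beta_h(f)\in H_n(\operatorname{Isom}^+(\mathbb H^n),\partial\mathbb H^n)$ be the image of the fundamental class under $$H_n(M_0,\partial M_0)= H_n(\Gamma,\mathcal C)\xrightarrow{(f,h)_*}H_n(\operatorname{Isom}^+(\mathbb H^n),\partial\mathbb H^n)$$ if $\partial M_0\neq\emptyset$, and under $$H_n(M_0)= H_n(\Gamma)\xrightarrow{f_*}H_n(\operatorname{Isom}^+(\mathbb H^n))\to H_n(\operatorname{Isom}^+(\mathbb H^n),\partial\mathbb H^n)$$ if $\partial M_0=\emptyset$, where the last map is the connecting homomorphism of $0\to J\partial\mathbb H^n\to\mathbb Z\partial\mathbb H^n\to\mathbb Z\to0$. Theorem. Such equivariant maps $h$ exist, and $\mu(\beta_h(f))\in P_n$ does not depend on the choice of $h$. That is, there is exactly one element $\beta(f)\in P_n$ with $\mu(\beta_h(f))=\beta(f)$ for every such $h$; it is an invariant of $M$ (with its orientation) and $f$. -/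

import Mathlib

noncomputable section

namespace HypBloch

open CategoryTheory

section PermutationModules

variable (R : Type) [CommRing R] (G : Type) [Group G] (Ω : Type) [MulAction G Ω]

/-- The augmentation `ε : RΩ → R`. -/
def augmentation : MonoidAlgebra R Ω →ₗ[R] R :=
  Finsupp.linearCombination R (fun _ : Ω => (1 : R)) ∘ₗ
    (MonoidAlgebra.coeffLinearEquiv R).toLinearMap

lemma augmentation_single (x : Ω) (m : R) :
    augmentation R Ω (MonoidAlgebra.single x m) = m := by
  simp [augmentation]

lemma augmentation_ofMulAction (g : G) (a : MonoidAlgebra R Ω) :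
    augmentation R Ω (Representation.ofMulAction R G Ω g a) = augmentation R Ω a := by
  have : augmentation R Ω ∘ₗ Representation.ofMulAction R G Ω g = augmentation R Ω := by
    ext; simp [augmentation_single]
  exact congr($this a)

/-- `JΩ`, the kernel of the augmentation `RΩ → R`, as a subrepresentation of `RΩ`. -/
def augKer : Subrepresentation (Representation.ofMulAction R G Ω) where
  toSubmodule := LinearMap.ker (augmentation R Ω)
  apply_mem_toSubmodule g v hv := by
    simpa [LinearMap.mem_ker, augmentation_ofMulAction] using hv

/-- `JΩ` as a `G`-module. -/
abbrev J : Rep.{0} R G := Rep.of (augKer R G Ω).toRepresentation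

/-- The inclusion `JΩ → RΩ`. -/
def jIncl : J R G Ω ⟶ Rep.ofMulAction R G Ω :=
  Rep.ofHom ⟨(augKer R G Ω).toSubmodule.subtype, fun g => by ext; rfl⟩

/-- The augmentation `RΩ → R` as a map of `G`-modules. -/
def augMap : Rep.ofMulAction R G Ω ⟶ Rep.trivial R G R :=
  Rep.ofHom ⟨augmentation R Ω, fun g => by
    ext x
    simp [augmentation_single]⟩

/-- The sequence `0 → JΩ → RΩ → R → 0` of `G`-modules. -/
def augSeq : ShortComplex (Rep.{0} R G) :=
  ShortComplex.mk (jIncl R G Ω) (augMap R G Ω) (by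
    ext x
    exact x.2)

lemma augSeq_shortExact [Nonempty Ω] : (augSeq R G Ω).ShortExact where
  exact := (forget₂ (Rep.{0} R G) (ModuleCat R)).reflects_exact_of_faithful _ <|
    (ShortComplex.moduleCat_exact_iff _).2 fun x hx => ⟨(⟨x, hx⟩ : (augKer R G Ω).toSubmodule), rfl⟩
  mono_f := (Rep.mono_iff_injective _).2 fun _ _ h => Subtype.ext h
  epi_g := (Rep.epi_iff_surjective _).2 fun m =>
    ⟨MonoidAlgebra.single (Classical.arbitrary Ω) m, augmentation_single R Ω _ m⟩

/-- The linear extension `RΩ → RΩ'` of a map of sets `Ω → Ω'`. -/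
def permMap {Ω Ω' : Type} (h : Ω → Ω') : MonoidAlgebra R Ω →ₗ[R] MonoidAlgebra R Ω' :=
  (MonoidAlgebra.coeffLinearEquiv R).symm.toLinearMap ∘ₗ Finsupp.lmapDomain R R h ∘ₗ
    (MonoidAlgebra.coeffLinearEquiv R).toLinearMap

lemma permMap_single {Ω Ω' : Type} (h : Ω → Ω') (x : Ω) (m : R) :
    permMap R h (MonoidAlgebra.single x m) = MonoidAlgebra.single (h x) m := by
  simp [permMap]

lemma augmentation_permMap {Ω Ω' : Type} (h : Ω → Ω') (a : MonoidAlgebra R Ω) :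
    augmentation R Ω' (permMap R h a) = augmentation R Ω a := by
  have : augmentation R Ω' ∘ₗ permMap R h = augmentation R Ω := by
    ext; simp [augmentation_single, permMap_single]
  exact congr($this a)

lemma permMap_ofMulAction {G G' Ω Ω' : Type} [Group G] [Group G'] [MulAction G Ω]
    [MulAction G' Ω'] (f : G →* G') (h : Ω → Ω')
    (hh : ∀ (g : G) (c : Ω), h (g • c) = f g • h c) (g : G) (a : MonoidAlgebra R Ω) :
    permMap R h (Representation.ofMulAction R G Ω g a) =
      Representation.ofMulAction R G' Ω' (f g) (permMap R h a) := by
  have : permMap R h ∘ₗ Representation.ofMulAction R G Ω g =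
      Representation.ofMulAction R G' Ω' (f g) ∘ₗ permMap R h := by
    ext x : 2
    simp [permMap_single, hh]
  exact congr($this a)

variable {G Ω} in
/-- A map of sets `h : Ω → Ω'` that is equivariant along `f : G → G'` induces `JΩ → JΩ'`. -/
def jMap {G' : Type} [Group G'] {Ω' : Type} [MulAction G' Ω'] (f : G →* G') (h : Ω → Ω')
    (hh : ∀ (g : G) (c : Ω), h (g • c) = f g • h c) : J R G Ω ⟶ Rep.res f (J R G' Ω') :=
  Rep.ofHom
    { toLinearMap := (permMap R h).restrict fun a ha => by
        simpa [augKer, LinearMap.mem_ker, augmentation_permMap] using ha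
      isIntertwining' := fun g => LinearMap.ext fun a =>
        Subtype.ext (permMap_ofMulAction R f h hh g a.1) }

/-- The relative homology `H_n(G, Ω; R) = Tor_{n-1}^{RG}(JΩ, R)`, that is `H_{n-1}(G; JΩ)`
(for `n ≥ 1`). -/
abbrev relHomology (n : ℕ) : ModuleCat R := groupHomology (J R G Ω) (n - 1)

end PermutationModules

section SimplexComplex

variable (R : Type) [CommRing R] (G : Type) [Group G] {Ω : Type} [MulAction G Ω]

variable (Ω) in
/-- The relations that define `S_q(Ω)_G`. -/
def simplexRel (q : ℕ) : Submodule R ((Fin (q + 1) → Ω) →₀ R) :=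
  Submodule.span R
    ({x | ∃ (τ : Equiv.Perm (Fin (q + 1))) (z : Fin (q + 1) → Ω),
        x = Finsupp.single z 1 - ((Equiv.Perm.sign τ : ℤ) : R) • Finsupp.single (z ∘ τ) 1} ∪
     {x | ∃ z : Fin (q + 1) → Ω, ¬ Function.Injective z ∧ x = Finsupp.single z 1} ∪
     {x | ∃ (g : G) (z : Fin (q + 1) → Ω), x = Finsupp.single (g • z) 1 - Finsupp.single z 1})

variable (Ω) in
/-- `S_q(Ω)_G`. -/
abbrev SimplexGroup (q : ℕ) : Type := ((Fin (q + 1) → Ω) →₀ R) ⧸ simplexRel R G Ω q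

/-- The generator `⟨z₀, …, z_q⟩`. -/
def simplex {q : ℕ} (z : Fin (q + 1) → Ω) : SimplexGroup R G Ω q :=
  (simplexRel R G Ω q).mkQ (Finsupp.single z 1)

lemma simplex_comp_perm {q : ℕ} (z : Fin (q + 1) → Ω) (τ : Equiv.Perm (Fin (q + 1))) :
    simplex R G z = ((Equiv.Perm.sign τ : ℤ) : R) • simplex R G (z ∘ τ) := by
  rw [← sub_eq_zero, simplex, simplex, ← map_smul, ← map_sub]
  exact (Submodule.Quotient.mk_eq_zero _).2
    (Submodule.subset_span (Or.inl (Or.inl ⟨τ, z, rfl⟩)))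

lemma simplex_of_not_injective {q : ℕ} (z : Fin (q + 1) → Ω) (hz : ¬ Function.Injective z) :
    simplex R G z = 0 :=
  (Submodule.Quotient.mk_eq_zero _).2 (Submodule.subset_span (Or.inl (Or.inr ⟨z, hz, rfl⟩)))

lemma simplex_smul {q : ℕ} (g : G) (z : Fin (q + 1) → Ω) :
    simplex R G (g • z) = simplex R G z := by
  rw [← sub_eq_zero, simplex, simplex, ← map_sub]
  exact (Submodule.Quotient.mk_eq_zero _).2 (Submodule.subset_span (Or.inr ⟨g, z, rfl⟩))

/-- The sum `∑ᵢ (-1)ⁱ ⟨z₀, …, ẑᵢ, …, z_{q+1}⟩` in `S_q(Ω)_G`. -/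
def simplexFaces {q : ℕ} (z : Fin (q + 2) → Ω) : SimplexGroup R G Ω q :=
  ∑ i : Fin (q + 2), (-1 : R) ^ (i : ℕ) • simplex R G (z ∘ i.succAbove)

lemma simplex_perm_succAbove {q : ℕ} (z : Fin (q + 2) → Ω) (τ : Equiv.Perm (Fin (q + 2)))
    (i : Fin (q + 2)) :
    (-1 : R) ^ (i : ℕ) • simplex R G (z ∘ τ ∘ i.succAbove) =
      ((Equiv.Perm.sign τ : ℤ) : R) • (-1 : R) ^ (τ i : ℕ) •
        simplex R G (z ∘ (τ i).succAbove) := by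
  set ρ : Equiv.Perm (Fin (q + 2)) := i.cycleRange.symm.trans (τ.trans (τ i).cycleRange) with hρ
  obtain ⟨⟨a, e⟩, hae⟩ := Equiv.Perm.decomposeFin.symm.surjective ρ
  have h0 : ρ 0 = 0 := by simp [hρ]
  have ha : a = 0 := by
    rw [← h0, ← hae, Equiv.Perm.decomposeFin_symm_apply_zero]
  subst ha
  have hs : ∀ j, ρ (Fin.succ j) = Fin.succ (e j) := fun j => by
    rw [← hae, Equiv.Perm.decomposeFin_symm_apply_succ]; simp
  have hsign : Equiv.Perm.sign e = (-1) ^ (τ i : ℕ) * Equiv.Perm.sign τ * (-1) ^ (i : ℕ) := by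
    have h1 : Equiv.Perm.sign ρ = Equiv.Perm.sign e := by
      rw [← hae, Equiv.Perm.decomposeFin.symm_sign]; simp
    rw [← h1, hρ, Equiv.Perm.sign_trans, Equiv.Perm.sign_trans, Equiv.Perm.sign_symm,
      Fin.sign_cycleRange, Fin.sign_cycleRange]
  have hcomp : z ∘ τ ∘ i.succAbove = (z ∘ (τ i).succAbove) ∘ e := by
    funext j
    have h2 := hs j
    simp only [hρ, Equiv.trans_apply, Fin.cycleRange_symm_succ] at h2
    have h3 := congrArg (τ i).cycleRange.symm h2
    rw [Equiv.symm_apply_apply, Fin.cycleRange_symm_succ] at h3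
    simp [h3]
  rw [hcomp, simplex_comp_perm R G (z ∘ (τ i).succAbove) e, hsign, smul_smul, smul_smul]
  congr 1
  rcases Int.units_eq_one_or (Equiv.Perm.sign τ) with h | h <;>
  rcases neg_one_pow_eq_or R (i : ℕ) with h' | h' <;>
  rcases neg_one_pow_eq_or R (τ i : ℕ) with h'' | h'' <;>
  simp [h, h', h'']

lemma simplexFaces_comp_perm {q : ℕ} (z : Fin (q + 2) → Ω) (τ : Equiv.Perm (Fin (q + 2))) :
    simplexFaces R G z = ((Equiv.Perm.sign τ : ℤ) : R) • simplexFaces R G (z ∘ τ) := by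
  have : simplexFaces R G (z ∘ τ) = ((Equiv.Perm.sign τ : ℤ) : R) • simplexFaces R G z := by
    simp only [simplexFaces, Function.comp_assoc, simplex_perm_succAbove, Finset.smul_sum]
    exact Equiv.sum_comp τ fun i =>
      ((Equiv.Perm.sign τ : ℤ) : R) • (-1 : R) ^ (i : ℕ) • simplex R G (z ∘ i.succAbove)
  rw [this, smul_smul, ← Int.cast_mul, ← Units.val_mul, Int.units_mul_self, Units.val_one,
    Int.cast_one, one_smul]

lemma simplexFaces_of_not_injective {q : ℕ} (z : Fin (q + 2) → Ω) (hz : ¬ Function.Injective z) :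
    simplexFaces R G z = 0 := by
  simp only [Function.Injective, not_forall] at hz
  obtain ⟨i, j, hij, hne⟩ := hz
  have hsw : z ∘ Equiv.swap i j = z := by
    funext k
    rcases eq_or_ne k i with rfl | hi
    · simp [hij]
    rcases eq_or_ne k j with rfl | hj
    · simp [hij]
    · simp [Equiv.swap_apply_of_ne_of_ne hi hj]
  have key := simplex_perm_succAbove R G z (Equiv.swap i j) i
  rw [← Function.comp_assoc, hsw, Equiv.Perm.sign_swap hne, Equiv.swap_apply_left] at key
  rw [simplexFaces, Finset.sum_eq_add i j hne _ (by simp) (by simp), key]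
  · simp
  · rintro k - ⟨hki, hkj⟩
    rw [simplex_of_not_injective, smul_zero]
    intro hinj
    obtain ⟨a, rfl⟩ := Fin.exists_succAbove_eq hki.symm
    obtain ⟨b, rfl⟩ := Fin.exists_succAbove_eq hkj.symm
    exact hne (congrArg _ (hinj hij))

lemma simplexFaces_smul {q : ℕ} (g : G) (z : Fin (q + 2) → Ω) :
    simplexFaces R G (g • z) = simplexFaces R G z := by
  refine Finset.sum_congr rfl fun i _ => ?_
  congr 1
  exact simplex_smul R G g (z ∘ i.succAbove)

variable (Ω) in
/-- The boundary map of `S_•(Ω)_G`,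
`∂⟨z₀, …, z_{q+1}⟩ = ∑ᵢ (-1)ⁱ ⟨z₀, …, ẑᵢ, …, z_{q+1}⟩`. -/
def simplexBoundary (q : ℕ) : SimplexGroup R G Ω (q + 1) →ₗ[R] SimplexGroup R G Ω q :=
  (simplexRel R G Ω (q + 1)).liftQ (Finsupp.linearCombination R (simplexFaces R G)) (by
    rw [simplexRel, Submodule.span_le]
    rintro _ ((⟨τ, z, rfl⟩ | ⟨z, hz, rfl⟩) | ⟨g, z, rfl⟩)
    · simp [← simplexFaces_comp_perm]
    · simp [simplexFaces_of_not_injective R G z hz]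
    · simp [simplexFaces_smul])

lemma simplexBoundary_simplex {q : ℕ} (z : Fin (q + 2) → Ω) :
    simplexBoundary R G Ω q (simplex R G z) =
      ∑ i : Fin (q + 2), (-1 : R) ^ (i : ℕ) • simplex R G (z ∘ i.succAbove) := by
  simp [simplexBoundary, simplex, simplexFaces]

lemma simplexGroup_hom_ext {q : ℕ} {N : Type} [AddCommGroup N] [Module R N]
    {f g : SimplexGroup R G Ω q →ₗ[R] N}
    (h : ∀ z : Fin (q + 1) → Ω, f (simplex R G z) = g (simplex R G z)) : f = g := by
  apply Submodule.linearMap_qext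
  ext z
  exact h z

lemma simplexBoundary_comp (q : ℕ) :
    simplexBoundary R G Ω q ∘ₗ simplexBoundary R G Ω (q + 1) = 0 := by
  refine simplexGroup_hom_ext R G fun z => ?_
  simp only [LinearMap.comp_apply, simplexBoundary_simplex, map_sum, map_smul, LinearMap.zero_apply,
    Finset.smul_sum, smul_smul, ← pow_add, Function.comp_assoc]
  rw [← Finset.sum_product']
  refine Finset.sum_involution (fun ij _ => (ij.1.succAbove ij.2, ij.2.predAbove ij.1)) ?_ ?_
    (by simp) ?_
  · rintro ⟨i, j⟩ -
    have : (i.succAbove j).succAbove ∘ (j.predAbove i).succAbove = i.succAbove ∘ j.succAbove :=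
      funext fun k => Fin.succAbove_succAbove_succAbove_predAbove i j k
    simp [this, Fin.neg_one_pow_succAbove_add_predAbove]
  · rintro ⟨i, j⟩ - - h
    exact Fin.succAbove_ne i j congr($h.1)
  · rintro ⟨i, j⟩ -
    simp [Fin.succAbove_succAbove_predAbove, Fin.predAbove_predAbove_succAbove]

variable (Ω) in
/-- The chain complex `S_•(Ω)_G`. -/
def simplexComplex : ChainComplex (ModuleCat.{0} R) ℕ :=
  ChainComplex.of (fun q => ModuleCat.of R (SimplexGroup R G Ω q))
    (fun q => ModuleCat.ofHom (simplexBoundary R G Ω q)) fun q => by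
      rw [← ModuleCat.ofHom_comp, simplexBoundary_comp]; rfl

end SimplexComplex

section Comparison

variable (R : Type) [CommRing R] (G : Type) [Group G] {Ω : Type} [MulAction G Ω]

/-- `ω ↦ ⟨γ₀ w, …, γ_k w, ω⟩`, extended linearly to `RΩ`. -/
def coneMap (w : Ω) {k : ℕ} (γ : Fin (k + 1) → G) :
    MonoidAlgebra R Ω →ₗ[R] SimplexGroup R G Ω (k + 1) :=
  Finsupp.linearCombination R
      (fun x : Ω => simplex R G (Fin.snoc (α := fun _ => Ω) (fun i => γ i • w) x)) ∘ₗ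
    (MonoidAlgebra.coeffLinearEquiv R).toLinearMap

lemma coneMap_single (w : Ω) {k : ℕ} (γ : Fin (k + 1) → G) (x : Ω) (m : R) :
    coneMap R G w γ (MonoidAlgebra.single x m) =
      m • simplex R G (Fin.snoc (α := fun _ => Ω) (fun i => γ i • w) x) := by
  simp [coneMap]

lemma coneMap_smul (w : Ω) {k : ℕ} (g : G) (γ : Fin (k + 1) → G) (a : MonoidAlgebra R Ω) :
    coneMap R G w (g • γ) (Representation.ofMulAction R G Ω g a) = coneMap R G w γ a := by
  have : coneMap R G w (g • γ) ∘ₗ Representation.ofMulAction R G Ω g = coneMap R G w γ := by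
    ext x
    simp only [LinearMap.comp_apply, MonoidAlgebra.lsingle_apply,
      Representation.ofMulAction_single, coneMap_single, one_smul]
    rw [← simplex_smul R G g (Fin.snoc (α := fun _ => Ω) (fun i => γ i • w) x)]
    congr 1
    funext i
    refine Fin.lastCases ?_ (fun i => ?_) i <;> simp [mul_smul]
  exact congr($this a)

lemma boundary_coneMap (w : Ω) {k : ℕ} (γ : Fin (k + 2) → G) (a : MonoidAlgebra R Ω) :
    simplexBoundary R G Ω (k + 1) (coneMap R G w γ a) =
      ∑ i : Fin (k + 2), (-1 : R) ^ (i : ℕ) • coneMap R G w (γ ∘ i.succAbove) a +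
        (-1 : R) ^ (k + 2) • augmentation R Ω a • simplex R G (fun i => γ i • w) := by
  have : simplexBoundary R G Ω (k + 1) ∘ₗ coneMap R G w γ =
      ∑ i : Fin (k + 2), (-1 : R) ^ (i : ℕ) • coneMap R G w (γ ∘ i.succAbove) +
        (-1 : R) ^ (k + 2) • (augmentation R Ω).smulRight (simplex R G (fun i => γ i • w)) := by
    ext x
    simp only [LinearMap.comp_apply, MonoidAlgebra.lsingle_apply, coneMap_single, one_smul,
      simplexBoundary_simplex, LinearMap.add_apply, LinearMap.sum_apply, LinearMap.smul_apply,
      LinearMap.smulRight_apply, augmentation_single]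
    rw [Fin.sum_univ_castSucc]
    congr 1
    · refine Finset.sum_congr rfl fun i _ => ?_
      congr 2
      funext j
      refine Fin.lastCases ?_ (fun j => ?_) j
      · simp
      · simp
    · congr 2
      funext j
      simp
  have h := congr($this a)
  simpa using h

/-- The degree `k` part of the comparison map. -/
def muChain (w : Ω) (k : ℕ) :
    ((Fin k → G) →₀ J R G Ω) →ₗ[R] SimplexGroup R G Ω (k + 1) :=
  Finsupp.lsum R fun g => coneMap R G w (Fin.partialProd g) ∘ₗ (augKer R G Ω).toSubmodule.subtype

lemma muChain_single (w : Ω) (k : ℕ) (g : Fin k → G) (a : J R G Ω) :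
    muChain R G w k (Finsupp.single g a) = coneMap R G w (Fin.partialProd g) a.1 := by
  simp [muChain]

lemma boundary_muChain (w : Ω) (k : ℕ) (x : (Fin (k + 1) → G) →₀ J R G Ω) :
    simplexBoundary R G Ω (k + 1) (muChain R G w (k + 1) x) =
      muChain R G w k (groupHomology.inhomogeneousChains.d (J R G Ω) k x) := by
  induction x using Finsupp.induction_linear with
  | zero => simp
  | add x y hx hy => simp only [map_add, hx, hy]
  | single g a =>
    rw [muChain_single, boundary_coneMap, groupHomology.inhomogeneousChains.d_single,
      map_add, muChain_single, map_sum]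
    simp only [map_smul]
    have ha : augmentation R Ω a.1 = 0 := a.2
    rw [ha, zero_smul, smul_zero, add_zero, Fin.sum_univ_succ]
    congr 1
    · rw [← coneMap_smul R G w (g 0) (Fin.partialProd fun i => g i.succ)]
      have h1 : Fin.partialProd g ∘ (0 : Fin (k + 2)).succAbove =
          g 0 • Fin.partialProd fun i : Fin k => g i.succ :=
        funext fun j => Fin.partialProd_succ' g j
      have h2 : Representation.ofMulAction R G Ω (g 0)
          ((J R G Ω).ρ (g 0)⁻¹ a : (augKer R G Ω).toSubmodule).1 = a.1 :=
        Representation.self_inv_apply _ _ _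
      rw [h1, h2]
      simp
    · refine Finset.sum_congr rfl fun i _ => ?_
      refine .trans ?_ (congrArg _ (muChain_single R G w k _ a).symm)
      rw [Fin.partialProd_contractNth, Fin.val_succ]

/-- The map in homology induced by three consecutive components of a map of chain complexes. -/
def homologyMapOfSc {R : Type} [CommRing R] {C D : ChainComplex (ModuleCat.{0} R) ℕ}
    (i j k i' j' k' : ℕ) (hi : i = j + 1) (hk : j = k + 1) (hi' : i' = j' + 1) (hk' : j' = k' + 1)
    (a : C.X i ⟶ D.X i') (b : C.X j ⟶ D.X j') (c : C.X k ⟶ D.X k')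
    (hab : a ≫ D.d i' j' = C.d i j ≫ b) (hbc : b ≫ D.d j' k' = C.d j k ≫ c) :
    C.homology j ⟶ D.homology j' :=
  (C.homologyIsoSc' i j k (by simp [hi]) (by simp [hk])).hom ≫
    ShortComplex.homologyMap (ShortComplex.homMk a b c hab hbc) ≫
    (D.homologyIsoSc' i' j' k' (by simp [hi']) (by simp [hk'])).inv

lemma simplexComplex_d (q : ℕ) : (simplexComplex R G Ω).d (q + 1) q =
    ModuleCat.ofHom (simplexBoundary R G Ω q) :=
  ChainComplex.of_d (fun q => ModuleCat.of R (SimplexGroup R G Ω q))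
    (fun q => ModuleCat.ofHom (simplexBoundary R G Ω q)) q

lemma muChain_comm (w : Ω) (k : ℕ) :
    ModuleCat.ofHom (muChain R G w (k + 1)) ≫ (simplexComplex R G Ω).d (k + 2) (k + 1) =
      (groupHomology.inhomogeneousChains (J R G Ω)).d (k + 1) k ≫
        ModuleCat.ofHom (muChain R G w k) := by
  rw [groupHomology.inhomogeneousChains.d_def, simplexComplex_d]
  refine ModuleCat.hom_ext (LinearMap.ext fun x => ?_)
  exact boundary_muChain R G w k _

/-- The comparison map `H_n(G, Ω; R) → H_n(S_•(Ω)_G)` for `n ≥ 2`. It is induced by a map, over the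
identity of `JΩ`, from the bar resolution of `JΩ` to the resolution
`⋯ → S₂(Ω) → S₁(Ω) → JΩ → 0`; such a map is unique up to homotopy, so that the choice of the
point of `Ω` in the formula for it is immaterial. -/
def mu [Nonempty Ω] : (n : ℕ) → 2 ≤ n → (relHomology R G Ω n ⟶ (simplexComplex R G Ω).homology n)
  | m + 2, _ =>
    homologyMapOfSc (m + 2) (m + 1) m (m + 3) (m + 2) (m + 1) rfl rfl rfl rfl
      (ModuleCat.ofHom (muChain R G (Classical.arbitrary Ω) (m + 2)))
      (ModuleCat.ofHom (muChain R G (Classical.arbitrary Ω) (m + 1)))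
      (ModuleCat.ofHom (muChain R G (Classical.arbitrary Ω) m))
      (muChain_comm R G _ (m + 1)) (muChain_comm R G _ m)

end Comparison

section Singular

variable (R : Type) [CommRing R]

/-- The singular chain complex of a space, with coefficients in `R`. -/
abbrev singularChains (X : Type) [TopologicalSpace X] : ChainComplex (ModuleCat.{0} R) ℕ :=
  (TopCat.toSSet.obj (TopCat.of X)).chainComplex (ModuleCat.of R R)

/-- The map of singular chain complexes induced by a continuous map. -/
abbrev singularChainsMap {X Y : Type} [TopologicalSpace X] [TopologicalSpace Y] (f : C(X, Y)) :
    singularChains R X ⟶ singularChains R Y :=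
  SSet.chainComplexMap (TopCat.toSSet.map (TopCat.ofHom f)) (ModuleCat.of R R)

lemma singularChainsMap_comp {X Y Z : Type} [TopologicalSpace X] [TopologicalSpace Y]
    [TopologicalSpace Z] (f : C(X, Y)) (g : C(Y, Z)) :
    singularChainsMap R f ≫ singularChainsMap R g = singularChainsMap R (g.comp f) := by
  rw [singularChainsMap, singularChainsMap, ← Functor.map_comp, ← Functor.map_comp]
  rfl

/-- The inclusion of a subspace. -/
def inclusionMap {X : Type} [TopologicalSpace X] (A : Set X) : C(A, X) :=
  ⟨Subtype.val, continuous_subtype_val⟩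

/-- The relative singular chain complex `C_•(X) / C_•(A)`. -/
abbrev relSingularChains {X : Type} [TopologicalSpace X] (A : Set X) :
    ChainComplex (ModuleCat.{0} R) ℕ :=
  Limits.cokernel (singularChainsMap R (inclusionMap A))

/-- The relative singular homology `H_n(X, A; R)`. -/
abbrev relSingularHomology {X : Type} [TopologicalSpace X] (A : Set X) (n : ℕ) : ModuleCat R :=
  (relSingularChains R A).homology n

/-- The map `H_n(X, A; R) → H_n(X, B; R)` for `A ⊆ B`. -/
def relSingularRestrict {X : Type} [TopologicalSpace X] {A B : Set X} (h : A ⊆ B) (n : ℕ) :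
    relSingularHomology R A n ⟶ relSingularHomology R B n :=
  HomologicalComplex.homologyMap
    (Limits.cokernel.map _ _ (singularChainsMap R ⟨Set.inclusion h, continuous_inclusion h⟩) (𝟙 _)
      (by rw [singularChainsMap_comp, Category.comp_id]; rfl)) n

/-- `ω ∈ H_n(X, A; R)` is a fundamental class of `(X, A)` if for all points `x ∉ A` it maps to a
generator of `H_n(X, X ∖ {x}; R)`. -/
def IsFundamentalClass {X : Type} [TopologicalSpace X] {A : Set X} {n : ℕ}
    (ω : relSingularHomology R A n) : Prop :=
  ∀ (x : X) (hx : x ∉ A) (y : relSingularHomology R ({x}ᶜ : Set X) n),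
    ∃ m : R, y = m • relSingularRestrict R (Set.subset_compl_singleton_iff.2 hx) n ω

end Singular

section Lifts

variable {M E Γ : Type} [TopologicalSpace M] [TopologicalSpace E] [Group Γ] [MulAction Γ E]
  {p : E → M}

lemma exists_lift (hp : IsQuotientCoveringMap p Γ) {k : ℕ} (σ : C(stdSimplex ℝ (Fin (k + 1)), M)) :
    ∃ τ : C(stdSimplex ℝ (Fin (k + 1)), E), p ∘ τ = σ := by
  have : ContractibleSpace (stdSimplex ℝ (Fin (k + 1))) :=
    (convex_stdSimplex ℝ (Fin (k + 1))).contractibleSpace ⟨_, (stdSimplex.vertex 0).2⟩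
  have : LocallyPathConnectedSpace (stdSimplex ℝ (Fin (k + 1))) :=
    (convex_stdSimplex ℝ (Fin (k + 1))).locallyPathConnectedSpace
  obtain ⟨e, he⟩ := hp.surjective (σ (stdSimplex.vertex 0))
  obtain ⟨τ, ⟨-, hτ⟩, -⟩ := hp.isCoveringMap.existsUnique_continuousMap_lifts σ _ e he
  exact ⟨τ, hτ⟩

lemma lift_unique (hp : IsQuotientCoveringMap p Γ) {k : ℕ} (τ τ' : C(stdSimplex ℝ (Fin (k + 1)), E)) (h : p ∘ τ = p ∘ τ') :
    ∃ g : Γ, ∀ z, τ z = g • τ' z := by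
  have := hp.toContinuousConstSMul
  obtain ⟨g, hg⟩ := hp.apply_eq_iff_mem_orbit.1 (congrFun h (stdSimplex.vertex 0))
  refine ⟨g, fun z => congrFun (hp.isCoveringMap.eq_of_comp_eq τ.continuous
    (g₂ := fun z => g • τ' z) (by fun_prop) ?_ (stdSimplex.vertex 0) hg.symm) z⟩
  funext z
  have := congrFun h z
  simp only [Function.comp_apply] at this ⊢
  rw [this, hp.map_smul]

/-- The vertices of a chosen lift of a singular simplex to the covering space. -/
def liftVertices (hp : IsQuotientCoveringMap p Γ) {k : ℕ}
    (σ : C(stdSimplex ℝ (Fin (k + 1)), M)) : Fin (k + 1) → E :=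
  fun i => (exists_lift hp σ).choose (stdSimplex.vertex i)

/-- The vertices of a lift are determined up to the group action. -/
lemma liftVertices_eq (hp : IsQuotientCoveringMap p Γ) {k : ℕ}
    {σ : C(stdSimplex ℝ (Fin (k + 1)), M)} (τ : C(stdSimplex ℝ (Fin (k + 1)), E))
    (h : p ∘ τ = σ) : ∃ g : Γ, liftVertices hp σ = g • fun i => τ (stdSimplex.vertex i) := by
  obtain ⟨g, hg⟩ := lift_unique hp (exists_lift hp σ).choose τ
    ((exists_lift hp σ).choose_spec.trans h.symm)
  exact ⟨g, funext fun i => hg _⟩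

lemma liftVertices_face (hp : IsQuotientCoveringMap p Γ) {k : ℕ}
    {σ : C(stdSimplex ℝ (Fin (k + 2)), M)} {σ' : C(stdSimplex ℝ (Fin (k + 1)), M)}
    (i : Fin (k + 2)) (h : ∀ z, σ' z = σ (stdSimplex.map i.succAbove z)) :
    ∃ g : Γ, liftVertices hp σ' = g • (liftVertices hp σ ∘ i.succAbove) := by
  have hc : Continuous (stdSimplex.map (S := ℝ) i.succAbove) := stdSimplex.continuous_map _
  obtain ⟨g, hg⟩ := liftVertices_eq hp (σ := σ')
    ((exists_lift hp σ).choose.comp ⟨stdSimplex.map i.succAbove, hc⟩) (by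
      funext z
      rw [h z]
      exact congrFun (exists_lift hp σ).choose_spec _)
  refine ⟨g, hg.trans ?_⟩
  congr 1
  funext j
  exact congrArg (exists_lift hp σ).choose (stdSimplex.map_vertex _ _)

variable (R : Type) [CommRing R]

/-- The linear map that sends a singular `k`-simplex of `M` to the value of `F` on the vertices of
a lift of the simplex to the covering space `E`. -/
def vertexMap (hp : IsQuotientCoveringMap p Γ) {k : ℕ} {N : ModuleCat.{0} R}
    (F : (Fin (k + 1) → E) → N) : (singularChains R M).X k ⟶ N :=
  (SSet.isColimitChainComplexXCofan (TopCat.toSSet.obj (TopCat.of M)) (ModuleCat.of R R) k).desc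
    (Limits.Cofan.mk N fun x => ModuleCat.ofHom (LinearMap.toSpanSingleton R _
      (F (liftVertices hp (TopCat.toSSetObjEquiv _ _ x)))))

lemma ι_vertexMap (hp : IsQuotientCoveringMap p Γ) {k : ℕ} {N : ModuleCat.{0} R}
    (F : (Fin (k + 1) → E) → N)
    (x : (TopCat.toSSet.obj (TopCat.of M)).obj (Opposite.op (SimplexCategory.mk k))) :
    (TopCat.toSSet.obj (TopCat.of M)).ιChainComplex x ≫ vertexMap R hp F =
      ModuleCat.ofHom (LinearMap.toSpanSingleton R _
        (F (liftVertices hp (TopCat.toSSetObjEquiv _ _ x)))) :=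
  (SSet.isColimitChainComplexXCofan (TopCat.toSSet.obj (TopCat.of M)) (ModuleCat.of R R) k).fac _
    ⟨x⟩

/-- The chain map given by functions `F_k` on `(k + 1)`-tuples of points of the covering space `E`
that are invariant under `Γ` and compatible with the boundary maps. -/
def chainMapOfVertices (hp : IsQuotientCoveringMap p Γ) {D : ChainComplex (ModuleCat.{0} R) ℕ}
    (F : ∀ k : ℕ, (Fin (k + 1) → E) → D.X k)
    (hF : ∀ (k : ℕ) (g : Γ) (v : Fin (k + 1) → E), F k (g • v) = F k v)
    (hd : ∀ (k : ℕ) (v : Fin (k + 2) → E),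
      D.d (k + 1) k (F (k + 1) v) =
        ∑ i : Fin (k + 2), (-1 : R) ^ (i : ℕ) • F k (v ∘ i.succAbove)) :
    singularChains R M ⟶ D where
  f k := vertexMap R hp (F k)
  comm' := by
    rintro _ k rfl
    refine SSet.chainComplex_hom_ext fun x => ?_
    rw [← Category.assoc, ι_vertexMap, SSet.ιChainComplex_d_assoc, Preadditive.sum_comp]
    simp only [Preadditive.zsmul_comp, ι_vertexMap]
    refine ModuleCat.hom_ext (LinearMap.ext_ring ?_)
    simp only [ModuleCat.hom_comp, ModuleCat.hom_ofHom, ModuleCat.hom_sum, ModuleCat.hom_zsmul,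
      LinearMap.comp_apply, LinearMap.sum_apply, LinearMap.smul_apply,
      LinearMap.toSpanSingleton_apply, one_smul]
    refine (hd k _).trans (Finset.sum_congr rfl fun i _ => ?_)
    obtain ⟨g, hg⟩ := liftVertices_face hp (σ := TopCat.toSSetObjEquiv _ _ x)
      (σ' := TopCat.toSSetObjEquiv _ _
        (SimplicialObject.δ (TopCat.toSSet.obj (TopCat.of M)) i x)) i fun z => rfl
    rw [hg, hF]
    rw [← Int.cast_smul_eq_zsmul R]
    push_cast
    rfl

lemma inclusion_chainMapOfVertices (hp : IsQuotientCoveringMap p Γ)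
    {D : ChainComplex (ModuleCat.{0} R) ℕ} (F : ∀ k : ℕ, (Fin (k + 1) → E) → D.X k)
    (hF : ∀ (k : ℕ) (g : Γ) (v : Fin (k + 1) → E), F k (g • v) = F k v)
    (hd : ∀ (k : ℕ) (v : Fin (k + 2) → E),
      D.d (k + 1) k (F (k + 1) v) =
        ∑ i : Fin (k + 2), (-1 : R) ^ (i : ℕ) • F k (v ∘ i.succAbove))
    (B : Set M)
    (h0 : ∀ (k : ℕ) (τ : C(stdSimplex ℝ (Fin (k + 1)), p ⁻¹' B)),
      F k (fun i => (τ (stdSimplex.vertex i)).1) = 0) :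
    singularChainsMap R (inclusionMap B) ≫ chainMapOfVertices R hp F hF hd = 0 := by
  refine HomologicalComplex.hom_ext _ _ fun k => SSet.chainComplex_hom_ext fun x => ?_
  rw [HomologicalComplex.comp_f, SSet.ι_chainComplexMap_f_assoc]
  refine (ι_vertexMap R hp (F k) _).trans ?_
  rw [HomologicalComplex.zero_f, Limits.comp_zero]
  refine ModuleCat.hom_ext (LinearMap.ext_ring ?_)
  set σ := TopCat.toSSetObjEquiv _ _ x
  obtain ⟨τ, hτ⟩ := exists_lift hp ((inclusionMap B).comp σ)
  obtain ⟨g, hg⟩ := liftVertices_eq hp τ hτ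
  simp only [ModuleCat.hom_ofHom, LinearMap.toSpanSingleton_apply, one_smul]
  have h1 := h0 k ⟨fun z => ⟨τ z, by
    have : p (τ z) = (σ z).1 := congrFun hτ z
    rw [Set.mem_preimage, this]; exact (σ z).2⟩, by fun_prop⟩
  rw [← hF k g] at h1
  refine Eq.trans ?_ h1
  exact congrArg (F k) hg

end Lifts


section Bar

variable (R : Type) [CommRing R] {Γ : Type} [Group Γ] (A : Rep.{0} R Γ)

/-- The inhomogeneous chain that corresponds to the generator `(γ₀, …, γ_k) ⊗ a` of the
coinvariants of the homogeneous bar resolution with coefficients in `A`. -/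
def homog {k : ℕ} (γ : Fin (k + 1) → Γ) (a : A) : (Fin k → Γ) →₀ A :=
  Finsupp.single (fun i => (γ i.castSucc)⁻¹ * γ i.succ) (A.ρ (γ 0)⁻¹ a)

lemma homog_smul {k : ℕ} (g : Γ) (γ : Fin (k + 1) → Γ) (a : A) :
    homog R A (fun i => g * γ i) (A.ρ g a) = homog R A γ a := by
  simp only [homog, mul_inv_rev, map_mul, Module.End.mul_apply, Representation.inv_self_apply]
  congr 1
  funext i
  group

lemma d_homog {k : ℕ} (γ : Fin (k + 2) → Γ) (a : A) :
    groupHomology.inhomogeneousChains.d A k (homog R A γ a) =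
      ∑ i : Fin (k + 2), (-1 : R) ^ (i : ℕ) • homog R A (γ ∘ i.succAbove) a := by
  rw [homog]
  refine (groupHomology.inhomogeneousChains.d_single _ _ _).trans ?_
  rw [Fin.sum_univ_succ (n := k + 1)]
  refine congrArg₂ (· + ·) ?_ (Finset.sum_congr rfl fun j _ => ?_)
  · simp only [homog, ← Module.End.mul_apply, ← map_mul]
    simp
  · have h2 : ∀ i, γ i = γ 0 * Fin.partialProd (fun i => (γ i.castSucc)⁻¹ * γ i.succ) i :=
      fun i => (congrFun (Fin.partialProd_left_inv γ) i).symm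
    rw [Fin.val_succ, homog]
    congr 2
    funext i
    rw [← Fin.inv_partialProd_mul_eq_contractNth, Function.comp_apply, Function.comp_apply,
      h2 (j.succ.succAbove i.castSucc), h2 (j.succ.succAbove i.succ), Fin.succ_succAbove_succ]
    group

end Bar

section Cusps

variable {M E Γ : Type} [TopologicalSpace M] [TopologicalSpace E] [Group Γ] [MulAction Γ E]
  {p : E → M}

/-- A chosen point in each orbit of the covering group. -/
def orbitPoint (hp : IsQuotientCoveringMap p Γ) (x : M) : E := (hp.surjective x).choose

lemma exists_smul_orbitPoint (hp : IsQuotientCoveringMap p Γ) (e : E) :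
    ∃ g : Γ, g • orbitPoint hp (p e) = e :=
  hp.apply_eq_iff_mem_orbit.1 (hp.surjective (p e)).choose_spec.symm

/-- An equivariant map from the covering space to the covering group. -/
def orbitSection (hp : IsQuotientCoveringMap p Γ) (e : E) : Γ := (exists_smul_orbitPoint hp e).choose

lemma orbitSection_spec (hp : IsQuotientCoveringMap p Γ) (e : E) :
    orbitSection hp e • orbitPoint hp (p e) = e :=
  (exists_smul_orbitPoint hp e).choose_spec

lemma orbitSection_smul (hp : IsQuotientCoveringMap p Γ) (g : Γ) (e : E) :
    orbitSection hp (g • e) = g * orbitSection hp e := by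
  have := hp.isCancelSMul
  refine IsCancelSMul.right_cancel _ _ (orbitPoint hp (p e)) ?_
  rw [mul_smul, orbitSection_spec]
  have h := orbitSection_spec hp (g • e)
  rwa [hp.map_smul g] at h

/-- The set of connected components of the preimage of `B ⊆ M` in the covering space, as a set with
an action of the covering group. -/
def Components (_hp : IsQuotientCoveringMap p Γ) (B : Set M) : Type :=
  ConnectedComponents (p ⁻¹' B)

/-- The action of an element of the covering group on the preimage of `B`. -/
def preimageSMul (hp : IsQuotientCoveringMap p Γ) (B : Set M) (g : Γ) (e : p ⁻¹' B) : p ⁻¹' B :=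
  ⟨g • e.1, by rw [Set.mem_preimage, hp.map_smul]; exact e.2⟩

lemma continuous_preimageSMul (hp : IsQuotientCoveringMap p Γ) (B : Set M) (g : Γ) :
    Continuous (preimageSMul hp B g) := by
  have := hp.toContinuousConstSMul
  exact ((continuous_const_smul g).comp continuous_subtype_val).subtype_mk _

instance instMulActionComponents (hp : IsQuotientCoveringMap p Γ) (B : Set M) : MulAction Γ (Components hp B) where
  smul g := (continuous_preimageSMul hp B g).connectedComponentsMap
  one_smul c := by
    obtain ⟨e, rfl⟩ := ConnectedComponents.surjective_coe c
    exact congrArg ConnectedComponents.mk (Subtype.ext (one_smul Γ e.1))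
  mul_smul g g' c := by
    obtain ⟨e, rfl⟩ := ConnectedComponents.surjective_coe c
    exact congrArg ConnectedComponents.mk (Subtype.ext (mul_smul g g' e.1))

/-- The component of a point of the preimage of `B`. -/
def componentOf (hp : IsQuotientCoveringMap p Γ) (B : Set M) (e : p ⁻¹' B) : Components hp B :=
  ConnectedComponents.mk e

lemma componentOf_smul (hp : IsQuotientCoveringMap p Γ) (B : Set M) (g : Γ) (e : p ⁻¹' B) :
    componentOf hp B (preimageSMul hp B g e) = g • componentOf hp B e := rfl

open Classical in
/-- An equivariant map from the covering space to the set of components of the preimage of `B` that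
sends each point of this preimage to its component. -/
def extendedComponent (hp : IsQuotientCoveringMap p Γ) (B : Set M) [Nonempty (Components hp B)]
    (e : E) : Components hp B :=
  if h : p e ∈ B then componentOf hp B ⟨e, h⟩ else orbitSection hp e • Classical.arbitrary _

lemma extendedComponent_smul (hp : IsQuotientCoveringMap p Γ) (B : Set M)
    [Nonempty (Components hp B)] (g : Γ) (e : E) :
    extendedComponent hp B (g • e) = g • extendedComponent hp B e := by
  by_cases h : p e ∈ B
  · have h' : p (g • e) ∈ B := by rwa [hp.map_smul]
    rw [extendedComponent, extendedComponent, dif_pos h, dif_pos h', ← componentOf_smul]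
    rfl
  · have h' : p (g • e) ∉ B := by rwa [hp.map_smul]
    rw [extendedComponent, extendedComponent, dif_neg h, dif_neg h', orbitSection_smul, mul_smul]

variable (R : Type) [CommRing R]

variable (Γ) in
/-- The element `y - x` of `JΩ`. -/
def jSub {Ω : Type} [MulAction Γ Ω] (y x : Ω) : J R Γ Ω :=
  (⟨MonoidAlgebra.single y 1 - MonoidAlgebra.single x 1, by
    simp [augKer, LinearMap.mem_ker, augmentation_single]⟩ : (augKer R Γ Ω).toSubmodule)

lemma jSub_smul {Ω : Type} [MulAction Γ Ω] (g : Γ) (y x : Ω) :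
    jSub Γ R (g • y) (g • x) = (J R Γ Ω).ρ g (jSub Γ R y x) := by
  refine Subtype.ext ?_
  refine Eq.symm ((map_sub (Representation.ofMulAction R Γ Ω g) _ _).trans ?_)
  rw [Representation.ofMulAction_single, Representation.ofMulAction_single]
  rfl

lemma jSub_self {Ω : Type} [MulAction Γ Ω] (x : Ω) : jSub Γ R x x = 0 :=
  Subtype.ext (sub_self _)

lemma jSub_sub_jSub {Ω : Type} [MulAction Γ Ω] (z y x : Ω) :
    jSub Γ R z x - jSub Γ R z y = jSub Γ R y x := by
  refine Subtype.ext ?_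
  exact sub_sub_sub_cancel_left _ _ _

/-- The chain complex of the inhomogeneous chains with coefficients in `JΩ`, shifted by one. -/
def shiftedChains (Γ : Type) [Group Γ] (Ω : Type) [MulAction Γ Ω] :
    ChainComplex (ModuleCat.{0} R) ℕ :=
  (groupHomology.inhomogeneousChains (J R Γ Ω)).augment (X := ModuleCat.of R PUnit) 0 (by simp)

/-- The value on the vertices of a simplex of the chain map that represents
`H_n(M, B) → H_n(Γ, Ω)`, where `Ω` is the set of components of the preimage of `B`:
`(v₀, …, v_{k+1}) ↦ (-1)ᵏ (v₁, …, v_{k+1}) ⊗ (c(v₁) - c(v₀))`. -/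
def relVertexValue (hp : IsQuotientCoveringMap p Γ) (B : Set M) [Nonempty (Components hp B)] :
    (k : ℕ) → (Fin (k + 1) → E) → (shiftedChains R Γ (Components hp B)).X k
  | 0, _ => (0 : PUnit)
  | k + 1, v => ((-1 : R) ^ k • homog R (J R Γ (Components hp B))
      (fun i : Fin (k + 1) => orbitSection hp (v i.succ))
      (jSub Γ R (extendedComponent hp B (v 1)) (extendedComponent hp B (v 0))) :
        (Fin k → Γ) →₀ J R Γ (Components hp B))

lemma shiftedChains_d_succ (Γ : Type) [Group Γ] (Ω : Type) [MulAction Γ Ω] (k : ℕ)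
    (x : (Fin (k + 1) → Γ) →₀ J R Γ Ω) :
    (shiftedChains R Γ Ω).d (k + 2) (k + 1) x =
      groupHomology.inhomogeneousChains.d (J R Γ Ω) k x := by
  have h : (shiftedChains R Γ Ω).d (k + 2) (k + 1) =
      (groupHomology.inhomogeneousChains (J R Γ Ω)).d (k + 1) k :=
    ChainComplex.augment_d_succ_succ _ _ _ _ _
  rw [h, groupHomology.inhomogeneousChains.d_def]
  rfl

/-- The identity map, in degree `k + 1` of the shifted complex. -/
def shiftMap {Γ : Type} [Group Γ] (Ω : Type) [MulAction Γ Ω] (k : ℕ) :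
    (shiftedChains R Γ Ω).X (k + 1) ⟶ (groupHomology.inhomogeneousChains (J R Γ Ω)).X k :=
  𝟙 ((groupHomology.inhomogeneousChains (J R Γ Ω)).X k)

lemma shiftMap_comm {Γ : Type} [Group Γ] (Ω : Type) [MulAction Γ Ω] (k : ℕ) :
    shiftMap R Ω (k + 1) ≫ (groupHomology.inhomogeneousChains (J R Γ Ω)).d (k + 1) k =
      (shiftedChains R Γ Ω).d (k + 2) (k + 1) ≫ shiftMap R Ω k := by
  rw [groupHomology.inhomogeneousChains.d_def]
  exact ModuleCat.hom_ext (LinearMap.ext fun x => (shiftedChains_d_succ R Γ Ω k x).symm)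

lemma sign_aux {N : Type} [AddCommGroup N] [Module R N] (k : ℕ) {m : ℕ} (x y : N) (h : Fin m → N) :
    (-1 : R) ^ (k + 1) • ((-1 : R) ^ ((0 : Fin (m + 1)) : ℕ) • (x - y) +
        ∑ j : Fin m, (-1 : R) ^ (j.succ : ℕ) • h j) =
      (-1 : R) ^ ((0 : Fin (m + 2)) : ℕ) • (-1 : R) ^ k • y +
        ((-1 : R) ^ ((0 : Fin (m + 1)).succ : ℕ) • (-1 : R) ^ k • x +
          ∑ j : Fin m, (-1 : R) ^ (j.succ.succ : ℕ) • (-1 : R) ^ k • h j) := by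
  rw [smul_add, Finset.smul_sum, ← add_assoc]
  refine congrArg₂ (· + ·) ?_ (Finset.sum_congr rfl fun j _ => ?_)
  · simp only [Fin.val_zero, Fin.val_succ, pow_succ, pow_zero]
    module
  · rw [smul_smul, smul_smul, Fin.val_succ, Fin.val_succ, Fin.val_succ]
    congr 1
    ring

lemma relVertexValue_smul (hp : IsQuotientCoveringMap p Γ) (B : Set M)
    [Nonempty (Components hp B)] (k : ℕ) (g : Γ) (v : Fin (k + 1) → E) :
    relVertexValue R hp B k (g • v) = relVertexValue R hp B k v := by
  cases k with
  | zero => rfl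
  | succ k =>
    simp only [relVertexValue, Pi.smul_apply, orbitSection_smul, extendedComponent_smul, jSub_smul]
    exact congrArg _ (homog_smul R (J R Γ (Components hp B)) g _ _)

lemma d_relVertexValue (hp : IsQuotientCoveringMap p Γ) (B : Set M)
    [Nonempty (Components hp B)] (k : ℕ) (v : Fin (k + 2) → E) :
    (shiftedChains R Γ (Components hp B)).d (k + 1) k (relVertexValue R hp B (k + 1) v) =
      ∑ i : Fin (k + 2), (-1 : R) ^ (i : ℕ) • relVertexValue R hp B k (v ∘ i.succAbove) := by
  cases k with
  | zero => exact Subsingleton.elim (α := PUnit) _ _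
  | succ k =>
    rw [relVertexValue]
    refine (shiftedChains_d_succ R Γ _ k _).trans ?_
    rw [map_smul, d_homog, Fin.sum_univ_succ (n := k + 1), Fin.sum_univ_succ (n := k + 2),
      Fin.sum_univ_succ (n := k + 1)]
    set c := extendedComponent hp B
    set s := orbitSection hp
    have e0 : relVertexValue R hp B (k + 1) (v ∘ (0 : Fin (k + 3)).succAbove) =
        (-1 : R) ^ k • homog R (J R Γ (Components hp B)) (fun i => s (v i.succ.succ))
          (jSub Γ R (c (v 2)) (c (v 1))) := rfl
    have e1 : relVertexValue R hp B (k + 1) (v ∘ (0 : Fin (k + 2)).succ.succAbove) =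
        (-1 : R) ^ k • homog R (J R Γ (Components hp B)) (fun i => s (v i.succ.succ))
          (jSub Γ R (c (v 2)) (c (v 0))) := by
      simp only [relVertexValue]
      refine congrArg _ (congrArg₂ _ (funext fun i => ?_) (congrArg₂ _ ?_ ?_))
      · rw [Function.comp_apply, Fin.succ_succAbove_succ]; rfl
      · rw [Function.comp_apply, ← Fin.succ_zero_eq_one, Fin.succ_succAbove_succ]; rfl
      · rw [Function.comp_apply, Fin.succ_succAbove_zero]
    have e2 : ∀ j : Fin (k + 1), relVertexValue R hp B (k + 1) (v ∘ j.succ.succ.succAbove) =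
        (-1 : R) ^ k • homog R (J R Γ (Components hp B))
          ((fun i : Fin (k + 2) => s (v i.succ)) ∘ j.succ.succAbove)
          (jSub Γ R (c (v 1)) (c (v 0))) := by
      intro j
      simp only [relVertexValue]
      refine congrArg _ (congrArg₂ _ (funext fun i => ?_) (congrArg₂ _ ?_ ?_))
      · rw [Function.comp_apply, Fin.succ_succAbove_succ]; rfl
      · rw [Function.comp_apply, ← Fin.succ_zero_eq_one, Fin.succ_succAbove_succ,
          Fin.succ_succAbove_zero, Fin.succ_zero_eq_one]
      · rw [Function.comp_apply, Fin.succ_succAbove_zero]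
    have e3 : homog R (J R Γ (Components hp B)) (fun i => s (v i.succ.succ))
          (jSub Γ R (c (v 1)) (c (v 0))) =
        homog R (J R Γ (Components hp B)) (fun i => s (v i.succ.succ))
          (jSub Γ R (c (v 2)) (c (v 0))) - homog R (J R Γ (Components hp B))
            (fun i => s (v i.succ.succ)) (jSub Γ R (c (v 2)) (c (v 1))) := by
      rw [← jSub_sub_jSub R (c (v 2)) (c (v 1)) (c (v 0)), homog, map_sub, Finsupp.single_sub]
      rfl
    have e4 : (fun i : Fin (k + 2) => s (v i.succ)) ∘ (0 : Fin (k + 2)).succAbove =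
      fun i => s (v i.succ.succ) := rfl
    rw [e0, e1, e4, e3]
    simp only [e2]
    exact sign_aux R k _ _ _

lemma relVertexValue_eq_zero (hp : IsQuotientCoveringMap p Γ) (B : Set M)
    [Nonempty (Components hp B)] (k : ℕ) (τ : C(stdSimplex ℝ (Fin (k + 1)), p ⁻¹' B)) :
    relVertexValue R hp B k (fun i => (τ (stdSimplex.vertex i)).1) = 0 := by
  cases k with
  | zero => rfl
  | succ k =>
    have h : ∀ z w, extendedComponent hp B (τ z).1 = extendedComponent hp B (τ w).1 := fun z w => by
      have hz : p (τ z).1 ∈ B := (τ z).2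
      have hw : p (τ w).1 ∈ B := (τ w).2
      rw [extendedComponent, extendedComponent, dif_pos hz, dif_pos hw]
      exact ConnectedComponents.coe_eq_coe'.2
        ((isPreconnected_range τ.continuous).subset_connectedComponent ⟨w, rfl⟩ ⟨z, rfl⟩)
    rw [relVertexValue, h _ (stdSimplex.vertex 0), jSub_self, homog, map_zero, Finsupp.single_zero,
      smul_zero]
    rfl

/-- The map `H_n(M, B; R) → H_n(Γ, Ω; R)`, for `n ≥ 2`, where `Ω` is the set of components of the
preimage of `B` in the covering space. -/
def relClassifying (hp : IsQuotientCoveringMap p Γ) (B : Set M) [Nonempty (Components hp B)] :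
    (n : ℕ) → 2 ≤ n → (relSingularHomology R B n ⟶ relHomology R Γ (Components hp B) n)
  | m + 2, _ =>
    HomologicalComplex.homologyMap
      (Limits.cokernel.desc _ (chainMapOfVertices R hp (relVertexValue R hp B)
          (relVertexValue_smul R hp B) (d_relVertexValue R hp B))
        (inclusion_chainMapOfVertices R hp _ _ _ B (relVertexValue_eq_zero R hp B))) (m + 2) ≫
      homologyMapOfSc (D := groupHomology.inhomogeneousChains (J R Γ (Components hp B)))
        (m + 3) (m + 2) (m + 1) (m + 2) (m + 1) m rfl rfl rfl rfl
        (shiftMap R _ _) (shiftMap R _ _) (shiftMap R _ _)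
        (shiftMap_comm R _ (m + 1)) (shiftMap_comm R _ m)

/-- The value on the vertices of a simplex of the chain map that represents `H_n(M) → H_n(Γ)`. -/
def absVertexValue (hp : IsQuotientCoveringMap p Γ) (k : ℕ) (v : Fin (k + 1) → E) :
    (groupHomology.inhomogeneousChains (Rep.trivial R Γ R)).X k :=
  (homog R (Rep.trivial R Γ R) (fun i => orbitSection hp (v i)) (1 : R) :
    (Fin k → Γ) →₀ Rep.trivial R Γ R)

/-- The map `H_n(M, B; R) = H_n(M; R) → H_n(Γ; R)` when `B` is empty. -/
def absClassifying (hp : IsQuotientCoveringMap p Γ) {B : Set M} (hB : IsEmpty (Components hp B))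
    (n : ℕ) : relSingularHomology R B n ⟶ groupHomology (Rep.trivial R Γ R) n :=
  HomologicalComplex.homologyMap
    (Limits.cokernel.desc _ (chainMapOfVertices R hp (absVertexValue R hp)
      (fun k g v => by
        simp only [absVertexValue, Pi.smul_apply, orbitSection_smul]
        exact homog_smul R (Rep.trivial R Γ R) g (fun i => orbitSection hp (v i)) (1 : R))
      (fun k v => by
        rw [groupHomology.inhomogeneousChains.d_def]
        exact d_homog R (Rep.trivial R Γ R) _ _))
      (inclusion_chainMapOfVertices R hp _ _ _ B fun k τ =>
        (hB.false (componentOf hp B (τ (stdSimplex.vertex 0)))).elim)) n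

end Cusps

section Hyperbolic

/-- The Lorentz form `-x₀y₀ + x₁y₁ + ⋯ + x_n y_n`. -/
def lor {n : ℕ} (x y : Fin (n + 1) → ℝ) : ℝ :=
  -(x 0 * y 0) + ∑ i : Fin n, x i.succ * y i.succ

lemma lor_smul_left {n : ℕ} (a : ℝ) (x y : Fin (n + 1) → ℝ) : lor (a • x) y = a * lor x y := by
  simp only [lor, Pi.smul_apply, smul_eq_mul, mul_add, Finset.mul_sum]
  congr 1
  · ring
  · exact Finset.sum_congr rfl fun _ _ => by ring

lemma lor_comm {n : ℕ} (x y : Fin (n + 1) → ℝ) : lor x y = lor y x := by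
  simp only [lor, mul_comm]

lemma lor_smul_smul {n : ℕ} (a : ℝ) (x : Fin (n + 1) → ℝ) :
    lor (a • x) (a • x) = a ^ 2 * lor x x := by
  rw [lor_smul_left, lor_comm, lor_smul_left]; ring

/-- Hyperbolic `n`-space as the upper sheet of the hyperboloid in Minkowski space; the hyperbolic
distance `d` is given by `cosh d(x, y) = -lor x y`. -/
def hypSpace (n : ℕ) : Set (Fin (n + 1) → ℝ) := {x | lor x x = -1 ∧ 0 < x 0}

/-- The group of orientation preserving isometries of hyperbolic `n`-space: the matrices of
determinant `1` that preserve the Lorentz form and map the upper sheet to itself. -/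
def IsomPlus (n : ℕ) : Subgroup (Matrix.SpecialLinearGroup (Fin (n + 1)) ℝ) where
  carrier := {A | (∀ x y, lor (A.1.mulVec x) (A.1.mulVec y) = lor x y) ∧
    ∀ x ∈ hypSpace n, A.1.mulVec x ∈ hypSpace n}
  one_mem' := by simp
  mul_mem' := by
    rintro A B ⟨hA, hA'⟩ ⟨hB, hB'⟩
    refine ⟨fun x y => ?_, fun x hx => ?_⟩
    · rw [Matrix.SpecialLinearGroup.coe_mul, ← Matrix.mulVec_mulVec, ← Matrix.mulVec_mulVec, hA, hB]
    · rw [Matrix.SpecialLinearGroup.coe_mul, ← Matrix.mulVec_mulVec]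
      exact hA' _ (hB' _ hx)
  inv_mem' := by
    rintro A ⟨hA, hA'⟩
    have hc : ∀ x, A.1.mulVec ((A⁻¹).1.mulVec x) = x := fun x => by
      rw [Matrix.mulVec_mulVec, ← Matrix.SpecialLinearGroup.coe_mul, mul_inv_cancel]
      simp
    have hl : ∀ x y, lor ((A⁻¹).1.mulVec x) ((A⁻¹).1.mulVec y) = lor x y := fun x y => by
      rw [← hA, hc, hc]
    refine ⟨hl, fun x hx => ⟨(hl x x).trans hx.1, ?_⟩⟩
    by_contra hneg
    set y := (A⁻¹).1.mulVec x with hy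
    have hyy : lor y y = -1 := (hl x x).trans hx.1
    have h0 : y 0 ≠ 0 := fun h => by
      have : 0 ≤ lor y y := by
        simp only [lor, h, mul_zero, neg_zero, zero_add]
        exact Finset.sum_nonneg fun i _ => mul_self_nonneg _
      linarith
    have hmem : (-1 : ℝ) • y ∈ hypSpace n := by
      refine ⟨by rw [lor_smul_smul, hyy]; norm_num, ?_⟩
      have : y 0 < 0 := lt_of_le_of_ne (not_lt.1 hneg) h0
      simpa using this
    have h1 := (hA' _ hmem).2
    rw [Matrix.mulVec_smul, hc] at h1
    have h2 := hx.2
    simp only [Pi.smul_apply, smul_eq_mul] at h1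
    linarith

lemma isomPlus_smul {n : ℕ} (g : IsomPlus n) (x : Fin (n + 1) → ℝ) :
    g • x = g.1.1.mulVec x := rfl

/-- The ideal boundary of hyperbolic `n`-space: the set of light-like lines in Minkowski space. -/
def HypBoundary (n : ℕ) : Type :=
  {l : Projectivization ℝ (Fin (n + 1) → ℝ) // lor l.rep l.rep = 0}

lemma lor_rep_mk {n : ℕ} {v : Fin (n + 1) → ℝ} (hv : v ≠ 0) :
    lor (Projectivization.mk ℝ v hv).rep (Projectivization.mk ℝ v hv).rep = 0 ↔ lor v v = 0 := by
  obtain ⟨a, ha⟩ := Projectivization.exists_smul_eq_mk_rep ℝ v hv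
  rw [← ha, Units.smul_def, lor_smul_smul]
  simp

instance instMulActionHypBoundary (n : ℕ) : MulAction (IsomPlus n) (HypBoundary n) where
  smul g l := ⟨g • l.1, by
    obtain ⟨l, hl⟩ := l
    induction l using Projectivization.ind with
    | h v hv =>
      refine (lor_rep_mk (v := g • v) ((smul_ne_zero_iff_ne g).mpr hv)).2 ?_
      rw [isomPlus_smul, g.2.1]
      exact (lor_rep_mk hv).1 hl⟩
  one_smul l := Subtype.ext (one_smul _ l.1)
  mul_smul g h l := Subtype.ext (mul_smul g h l.1)

instance instNonemptyHypBoundary (n : ℕ) [NeZero n] : Nonempty (HypBoundary n) := by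
  obtain ⟨m, rfl⟩ := Nat.exists_eq_succ_of_ne_zero (NeZero.ne n)
  have hv : (Fin.cons 1 (Fin.cons 1 0) : Fin (m + 2) → ℝ) ≠ 0 := fun h => by
    simpa using congrFun h 0
  refine ⟨⟨Projectivization.mk ℝ _ hv, (lor_rep_mk hv).2 ?_⟩⟩
  simp [lor, Fin.sum_univ_succ]

end Hyperbolic

section Invariant

/-- The boundary of a manifold with boundary of dimension `n`. -/
abbrev manifoldBoundary (n : ℕ) [NeZero n] (M : Type) [TopologicalSpace M]
    [ChartedSpace (EuclideanHalfSpace n) M] : Set M :=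
  (modelWithCornersEuclideanHalfSpace n).boundary M

/-- The group `P_n = H_n(S_•(∂ℍⁿ)_{Isom⁺(ℍⁿ)})`. -/
abbrev P (n : ℕ) : ModuleCat.{0} ℤ := (simplexComplex ℤ (IsomPlus n) (HypBoundary n)).homology n

/-- The map of trivial representations `R → f^* R`. -/
def trivialMap (R : Type) [CommRing R] {G H : Type} [Group G] [Group H] (f : G →* H) :
    Rep.trivial R G R ⟶ Rep.res f (Rep.trivial R H R) :=
  Rep.ofHom ⟨LinearMap.id, fun _ => rfl⟩

variable {M E Γ : Type} [TopologicalSpace M] [TopologicalSpace E] [Group Γ] [MulAction Γ E]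
  {p : E → M}

/-- A map `h` from the set of components of the preimage of `B` to `∂ℍⁿ` that is equivariant
with respect to `f : Γ → Isom⁺(ℍⁿ)`. -/
structure CuspMap (hp : IsQuotientCoveringMap p Γ) (B : Set M) {n : ℕ} (f : Γ →* IsomPlus n) where
  /-- The underlying map. -/
  toFun : Components hp B → HypBoundary n
  map_smul' : ∀ (g : Γ) (c : Components hp B), toFun (g • c) = f g • toFun c

open Classical in
/-- The class `β_h(f) ∈ H_n(Isom⁺(ℍⁿ), ∂ℍⁿ)`: the image of the fundamental class `ω` of `(M, B)`
under `H_n(M, B) → H_n(Γ, Ω) → H_n(Isom⁺(ℍⁿ), ∂ℍⁿ)`, where `Ω` is the set of components of the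
preimage of `B`, if this set is not empty, and under
`H_n(M) → H_n(Γ) → H_n(Isom⁺(ℍⁿ)) → H_n(Isom⁺(ℍⁿ), ∂ℍⁿ)` if it is empty. -/
def beta {hp : IsQuotientCoveringMap p Γ} {B : Set M} {n : ℕ} [NeZero n] (hn : 2 ≤ n)
    {f : Γ →* IsomPlus n} (h : CuspMap hp B f) (ω : relSingularHomology ℤ B n) :
    relHomology ℤ (IsomPlus n) (HypBoundary n) n :=
  if hB : Nonempty (Components hp B) then
    groupHomology.map f (jMap ℤ f h.toFun h.map_smul') (n - 1) (relClassifying ℤ hp B n hn ω)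
  else
    groupHomology.δ (augSeq_shortExact ℤ (IsomPlus n) (HypBoundary n)) n (n - 1) (by omega)
      (groupHomology.map f (trivialMap ℤ f) n
        (absClassifying ℤ hp (not_nonempty_iff.1 hB) n ω))

end Invariant

end HypBloch

end

open HypBloch

noncomputable section

namespace HypBloch

open CategoryTheory

/-! ### Chain homotopies seen through three consecutive degrees -/

section Homology

/-! Write Ω for the set of cusps and Ω' for ∂ℍⁿ. Two equivariant maps `h`, `h'` from Ω to Ω' induce
maps JΩ → JΩ' that need not agree, so there is no reason for the classes β in relative homology to
coincide. The difference of the two maps is the restriction to JΩ of c ↦ h' c - h c, and this lifts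
equivariantly to S₁(Ω') by c ↦ ⟨h c, h' c⟩. A map that factors through S₁(Ω') → JΩ' affects the
comparison with S_•(Ω')_G, up to homotopy, only in its lowest degree. Hence μ cannot see it in H_n
for n ≥ 2.

The homotopy is explicit. With a base point w, the comparison sends a bar simplex (γ₀, …, γ_k) with
coefficient c to the cone ⟨γ₀ w, …, γ_k w, c⟩; replacing its last vertex by the edge from h c to h'
c gives the prism ⟨γ₀ w, …, γ_k w, h c, h' c⟩. Deleting one of the γᵢ w reproduces the bar
differential, and deleting h c or h' c leaves the cones of the two push-forwards
(`boundary_prismMap`, `boundary_prismChain`). With a single γ₀ there would be a further face ⟨h c,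
h' c⟩, the lift above; it occurs only in bar degree 0, whereas H_n(Γ, Ω) sits in bar degree n - 1 ≥
1. Points that happen to coincide cause no trouble, since degenerate tuples are zero and the
boundary formula holds for all tuples.

The result is an equality of homomorphisms on H_n(Γ, Ω), `map_jMap_comp_mu_eq`, which is then
applied to the image of the fundamental class. Without cusps, β is defined by a formula in which `h`
does not occur. Existence of `h` is `exists_equivariant`: choose a fixed point for one cusp in each
orbit and transport it by f. -/

/-- Two maps of short complexes induce the same map in homology if their middle components differ
by the sum of a map that factors through `S₁.g` and of a map that factors through `S₂.f`. -/
lemma shortComplex_homologyMap_eq {C : Type*} [Category* C] [Abelian C] {S₁ S₂ : ShortComplex C}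
    (φ ψ : S₁ ⟶ S₂) (s : S₁.X₂ ⟶ S₂.X₁) (t : S₁.X₃ ⟶ S₂.X₂)
    (h : φ.τ₂ = S₁.g ≫ t + s ≫ S₂.f + ψ.τ₂) :
    ShortComplex.homologyMap φ = ShortComplex.homologyMap ψ :=
  ShortComplex.Homotopy.homologyMap_congr
    -- The outer terms `h₀` and `h₃` are forced by `comm₁` and `comm₃`. They are admissible because
    -- the error left over in the middle is `S₁.g ≫ t` on one side and `s ≫ S₂.f` on the other,
    -- which vanish after composing with `S₁.f` and `S₂.g` respectively.
    { h₀ := φ.τ₁ - ψ.τ₁ - S₁.f ≫ s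
      h₀_f := by simp [Preadditive.sub_comp, φ.comm₁₂, ψ.comm₁₂, h]
      h₁ := s
      h₂ := t
      h₃ := φ.τ₃ - ψ.τ₃ - t ≫ S₂.g
      g_h₃ := by simp [Preadditive.comp_sub, ← φ.comm₂₃, ← ψ.comm₂₃, h]
      comm₁ := by abel
      comm₂ := h
      comm₃ := by abel }

/-- Homology in degree `j` depends only on the three terms around it, so a homotopy relation in that
one degree suffices; no full chain homotopy has to be built. The target degree `j'` is independent
of `j` because `mu` shifts degrees by one. -/
lemma homologyMap_homologyMapOfSc_eq {R : Type} [CommRing R]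
    {C₀ C D : ChainComplex (ModuleCat.{0} R) ℕ} (F F' : C₀ ⟶ C)
    (i j k i' j' k' : ℕ) (hi : i = j + 1) (hk : j = k + 1) (hi' : i' = j' + 1) (hk' : j' = k' + 1)
    (a : C.X i ⟶ D.X i') (b : C.X j ⟶ D.X j') (c : C.X k ⟶ D.X k')
    (hab : a ≫ D.d i' j' = C.d i j ≫ b) (hbc : b ≫ D.d j' k' = C.d j k ≫ c)
    (s : C₀.X j ⟶ D.X i') (t : C₀.X k ⟶ D.X j')
    (h : F.f j ≫ b = C₀.d j k ≫ t + s ≫ D.d i' j' + F'.f j ≫ b) :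
    HomologicalComplex.homologyMap F j ≫
        homologyMapOfSc i j k i' j' k' hi hk hi' hk' a b c hab hbc =
      HomologicalComplex.homologyMap F' j ≫
        homologyMapOfSc i j k i' j' k' hi hk hi' hk' a b c hab hbc := by
  have hp : (ComplexShape.down ℕ).prev j = i := by simp [hi]
  have hn : (ComplexShape.down ℕ).next j = k := by simp [hk]
  -- Naturality of the identification with three-term homology moves `F` inside, next to the map
  -- given by `a`, `b`, `c`, so that the two composites can be compared as maps of short complexes.
  have nat : ∀ F : C₀ ⟶ C, HomologicalComplex.homologyMap F j ≫
      (C.homologyIsoSc' i j k hp hn).hom = (C₀.homologyIsoSc' i j k hp hn).hom ≫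
        ShortComplex.homologyMap
          ((HomologicalComplex.shortComplexFunctor' _ _ i j k).map F) := fun F =>
    (HomologicalComplex.homologyFunctorIso' (ModuleCat.{0} R) (ComplexShape.down ℕ)
      i j k hp hn).hom.naturality F
  have e : ShortComplex.homologyMap
        ((HomologicalComplex.shortComplexFunctor' _ _ i j k).map F) ≫
        ShortComplex.homologyMap
          (ShortComplex.homMk (S₁ := C.sc' i j k) (S₂ := D.sc' i' j' k') a b c hab hbc) =
      ShortComplex.homologyMap ((HomologicalComplex.shortComplexFunctor' _ _ i j k).map F') ≫
        ShortComplex.homologyMap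
          (ShortComplex.homMk (S₁ := C.sc' i j k) (S₂ := D.sc' i' j' k') a b c hab hbc) := by
    rw [← ShortComplex.homologyMap_comp, ← ShortComplex.homologyMap_comp]
    exact shortComplex_homologyMap_eq _ _ s t h
  rw [homologyMapOfSc, reassoc_of% (nat F), reassoc_of% (nat F'), reassoc_of% e]

end Homology

/-! ### The prism homotopy between two equivariant maps -/

section Prism

variable (R : Type) [CommRing R] {Γ G Ω Ω' : Type} [Group Γ] [Group G] [MulAction Γ Ω]
  [MulAction G Ω']

/-- `c ↦ ⟨γ₀ w, …, γ_k w, h c, h' c⟩`, extended linearly to `RΩ`. -/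
def prismMap (w : Ω') (h h' : Ω → Ω') {k : ℕ} (γ : Fin (k + 1) → G) :
    MonoidAlgebra R Ω →ₗ[R] SimplexGroup R G Ω' (k + 2) :=
  Finsupp.linearCombination R
      (fun x : Ω => simplex R G (Fin.snoc (α := fun _ => Ω')
        (Fin.snoc (α := fun _ => Ω') (fun i => γ i • w) (h x)) (h' x))) ∘ₗ
    (MonoidAlgebra.coeffLinearEquiv R).toLinearMap

lemma prismMap_single (w : Ω') (h h' : Ω → Ω') {k : ℕ} (γ : Fin (k + 1) → G) (x : Ω) (m : R) :
    prismMap R w h h' γ (MonoidAlgebra.single x m) =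
      m • simplex R G (Fin.snoc (α := fun _ => Ω')
        (Fin.snoc (α := fun _ => Ω') (fun i => γ i • w) (h x)) (h' x)) := by
  simp [prismMap]

/-- Equivariance of both `h` and `h'` makes the whole tuple move by `f g`, and translates are
identified in the coinvariants. This is what makes the prism compatible with the first term of the
bar differential. -/
lemma prismMap_smul (w : Ω') {h h' : Ω → Ω'} (f : Γ →* G)
    (hh : ∀ (g : Γ) (c : Ω), h (g • c) = f g • h c)
    (hh' : ∀ (g : Γ) (c : Ω), h' (g • c) = f g • h' c)
    {k : ℕ} (g : Γ) (γ : Fin (k + 1) → G) (a : MonoidAlgebra R Ω) :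
    prismMap R w h h' (f g • γ) (Representation.ofMulAction R Γ Ω g a) =
      prismMap R w h h' γ a := by
  have : prismMap R w h h' (f g • γ) ∘ₗ Representation.ofMulAction R Γ Ω g =
      prismMap R w h h' γ := by
    ext x
    simp only [LinearMap.comp_apply, MonoidAlgebra.lsingle_apply,
      Representation.ofMulAction_single, prismMap_single, one_smul]
    rw [← simplex_smul R G (f g) (Fin.snoc (α := fun _ => Ω')
      (Fin.snoc (α := fun _ => Ω') (fun i => γ i • w) (h x)) (h' x))]
    congr 1
    funext i
    refine Fin.lastCases ?_ (fun i => Fin.lastCases ?_ (fun i => ?_) i) i <;>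
      simp [mul_smul, hh, hh']
  exact congr($this a)

/-- There are at least two group vertices, so every face that omits one of them is again a prism. In
contrast to `boundary_coneMap` no augmentation term appears: each face that omits an endpoint of the
edge still contains the other endpoint, so the formula holds on all of RΩ. -/
lemma boundary_prismMap (w : Ω') (h h' : Ω → Ω') {k : ℕ} (γ : Fin (k + 2) → G)
    (a : MonoidAlgebra R Ω) :
    simplexBoundary R G Ω' (k + 2) (prismMap R w h h' γ a) =
      ∑ i : Fin (k + 2), (-1 : R) ^ (i : ℕ) • prismMap R w h h' (γ ∘ i.succAbove) a +
        (-1 : R) ^ (k + 2) • coneMap R G w γ (permMap R h' a) +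
        (-1 : R) ^ (k + 3) • coneMap R G w γ (permMap R h a) := by
  have : simplexBoundary R G Ω' (k + 2) ∘ₗ prismMap R w h h' γ =
      ∑ i : Fin (k + 2), (-1 : R) ^ (i : ℕ) • prismMap R w h h' (γ ∘ i.succAbove) +
        (-1 : R) ^ (k + 2) • coneMap R G w γ ∘ₗ permMap R h' +
        (-1 : R) ^ (k + 3) • coneMap R G w γ ∘ₗ permMap R h := by
    ext x
    simp only [LinearMap.comp_apply, MonoidAlgebra.lsingle_apply, prismMap_single, one_smul,
      simplexBoundary_simplex, LinearMap.add_apply, LinearMap.sum_apply, LinearMap.smul_apply,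
      permMap_single, coneMap_single]
    -- Splitting off the last two indices isolates the face without h x, at index k + 2, which is
    -- the cone over h' x, and the face without h' x, at index k + 3, which is the cone over h x.
    rw [Fin.sum_univ_castSucc, Fin.sum_univ_castSucc]
    refine congrArg₂ (· + ·) (congrArg₂ (· + ·) (Finset.sum_congr rfl fun i _ => ?_) ?_) ?_
    · congr 2
      funext j
      refine Fin.lastCases ?_ (fun j => Fin.lastCases ?_ (fun j => ?_) j) j <;> simp
    · congr 2
      funext j
      refine Fin.lastCases ?_ (fun j => ?_) j <;> simp
    · congr 2
      funext j
      simp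
  simpa using congr($this a)

/-- The homotopy between the chain maps given by two equivariant maps `h` and `h'`. -/
def prismChain (w : Ω') (h h' : Ω → Ω') (f : Γ →* G) (k : ℕ) :
    ((Fin k → Γ) →₀ J R Γ Ω) →ₗ[R] SimplexGroup R G Ω' (k + 2) :=
  Finsupp.lsum R fun g => prismMap R w h h' (Fin.partialProd (f ∘ g)) ∘ₗ
    (augKer R Γ Ω).toSubmodule.subtype

lemma prismChain_single (w : Ω') (h h' : Ω → Ω') (f : Γ →* G) (k : ℕ) (g : Fin k → Γ)
    (a : J R Γ Ω) :
    prismChain R w h h' f k (Finsupp.single g a) =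
      prismMap R w h h' (Fin.partialProd (f ∘ g)) a.1 := by
  simp [prismChain]

/-- Puts the comparison map after a push-forward into the shape of the two cone terms of
`boundary_prismMap`. -/
lemma muChain_chainsMap_single (w : Ω') {h : Ω → Ω'} (f : Γ →* G)
    (hh : ∀ (g : Γ) (c : Ω), h (g • c) = f g • h c) (k : ℕ) (g : Fin k → Γ) (a : J R Γ Ω) :
    muChain R G w k ((groupHomology.chainsMap f (jMap R f h hh)).f k (Finsupp.single g a)) =
      coneMap R G w (Fin.partialProd (f ∘ g)) (permMap R h a.1) :=
  (congrArg _ (groupHomology.chainsMap_f_single f (jMap R f h hh) k g a)).trans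
    (muChain_single R G w k _ _)

/-- On a generator this is `boundary_prismMap` for the partial products of the bar entries, matched
term by term with the inhomogeneous differential. The two cone terms have signs (-1)^(k+2) and
(-1)^(k+3), whence the factor (-1)^k and the difference. -/
lemma boundary_prismChain (w : Ω') {h h' : Ω → Ω'} (f : Γ →* G)
    (hh : ∀ (g : Γ) (c : Ω), h (g • c) = f g • h c)
    (hh' : ∀ (g : Γ) (c : Ω), h' (g • c) = f g • h' c) (k : ℕ)
    (x : (Fin (k + 1) → Γ) →₀ J R Γ Ω) :
    simplexBoundary R G Ω' (k + 2) (prismChain R w h h' f (k + 1) x) =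
      prismChain R w h h' f k (groupHomology.inhomogeneousChains.d (J R Γ Ω) k x) +
        (-1 : R) ^ k •
          (muChain R G w (k + 1) ((groupHomology.chainsMap f (jMap R f h' hh')).f (k + 1) x) -
            muChain R G w (k + 1) ((groupHomology.chainsMap f (jMap R f h hh)).f (k + 1) x)) := by
  induction x using Finsupp.induction_linear with
  | zero => simp
  | add x y hx hy =>
    simp only [map_add, hx, hy]
    module
  | single g a =>
    rw [muChain_chainsMap_single, muChain_chainsMap_single, prismChain_single, boundary_prismMap,
      groupHomology.inhomogeneousChains.d_single, map_add, prismChain_single, map_sum]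
    simp only [map_smul]
    rw [Fin.sum_univ_succ, add_assoc]
    refine congrArg₂ (· + ·) (congrArg₂ (· + ·) ?_ (Finset.sum_congr rfl fun i _ => ?_)) ?_
    -- Omitting the initial 1 from the partial products leaves the `f (g 0)`-translate of those of
    -- the shortened tuple. Invariance moves the translation to the coefficient, which accounts for
    -- the (g 0)⁻¹ in the bar differential.
    · rw [← prismMap_smul R w f hh hh' (g 0) (Fin.partialProd (f ∘ fun i => g i.succ))]
      have h1 : Fin.partialProd (f ∘ g) ∘ (0 : Fin (k + 2)).succAbove =
          f (g 0) • Fin.partialProd (f ∘ fun i : Fin k => g i.succ) :=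
        funext fun j => Fin.partialProd_succ' (f ∘ g) j
      have h2 : Representation.ofMulAction R Γ Ω (g 0)
          ((J R Γ Ω).ρ (g 0)⁻¹ a : (augKer R Γ Ω).toSubmodule).1 = a.1 :=
        Representation.self_inv_apply _ _ _
      rw [h1, h2]
      simp
    -- Omitting a later partial product multiplies two neighbouring bar entries, or drops the last
    -- entry; f commutes with this because it is multiplicative.
    · refine .trans ?_ (congrArg _ (prismChain_single R w h h' f k _ a).symm)
      rw [Fin.comp_contractNth _ _ (map_mul f), Fin.partialProd_contractNth, Fin.val_succ]
    · simp only [pow_succ]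
      module

/-- The image of `H_n(Γ, Ω)` in `H_n(S_•(Ω')_G)` does not depend on the equivariant map
`Ω → Ω'`. -/
lemma map_jMap_comp_mu_eq [Nonempty Ω'] (f : Γ →* G) {h h' : Ω → Ω'}
    (hh : ∀ (g : Γ) (c : Ω), h (g • c) = f g • h c)
    (hh' : ∀ (g : Γ) (c : Ω), h' (g • c) = f g • h' c) (n : ℕ) (hn : 2 ≤ n) :
    groupHomology.map f (jMap R f h hh) (n - 1) ≫ mu (Ω := Ω') R G n hn =
      groupHomology.map f (jMap R f h' hh') (n - 1) ≫ mu R G n hn := by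
  obtain ⟨m, rfl⟩ := Nat.exists_eq_add_of_le' hn
  -- The base point has to be the one used in `mu`, so that the faces of the prism are literally
  -- values of the comparison map.
  set w : Ω' := Classical.arbitrary Ω'
  refine homologyMap_homologyMapOfSc_eq _ _ (m + 2) (m + 1) m (m + 3) (m + 2) (m + 1)
    rfl rfl rfl rfl _ _ _ _ _
    -- `boundary_prismChain` computes ∂P - Pd, where a homotopy needs a sum; hence the opposite
    -- signs in the two degrees. The common factor (-1)^m cancels the sign in front of the
    -- difference.
    (ModuleCat.ofHom (-(-1 : R) ^ m • prismChain R w h h' f (m + 1)))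
    (ModuleCat.ofHom ((-1 : R) ^ m • prismChain R w h h' f m)) ?_
  rw [groupHomology.inhomogeneousChains.d_def, simplexComplex_d]
  refine ModuleCat.hom_ext (LinearMap.ext fun x => ?_)
  have key := boundary_prismChain R w f hh hh' m x
  have e : (-1 : R) ^ m * (-1) ^ m = 1 := by rw [← mul_pow]; simp
  change muChain R G w (m + 1) ((groupHomology.chainsMap f (jMap R f h hh)).f (m + 1) x) =
    (-1 : R) ^ m • prismChain R w h h' f m
        (groupHomology.inhomogeneousChains.d (J R Γ Ω) m x) +
      simplexBoundary R G Ω' (m + 2) ((-(-1 : R) ^ m) • prismChain R w h h' f (m + 1) x) +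
      muChain R G w (m + 1) ((groupHomology.chainsMap f (jMap R f h' hh')).f (m + 1) x)
  rw [map_smul, key, smul_add, smul_smul, neg_mul, e]
  module

end Prism

/-! ### Existence of equivariant maps -/

section Existence

/-- Equivariant maps `Ω → Ω'` exist if all point stabilizers have fixed points. -/
lemma exists_equivariant {Γ G Ω Ω' : Type} [Group Γ] [Group G] [MulAction Γ Ω] [MulAction G Ω']
    (f : Γ →* G) (hf : ∀ c : Ω, ∃ x : Ω', ∀ g ∈ MulAction.stabilizer Γ c, f g • x = x) :
    ∃ h : Ω → Ω', ∀ (g : Γ) (c : Ω), h (g • c) = f g • h c := by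
  choose y hy using hf
  -- `r c` is the chosen representative of the orbit of c, and `t c` below carries it to c. Only the
  -- fixed points of representatives enter the map.
  let r : Ω → Ω := fun c => (Quotient.mk (MulAction.orbitRel Γ Ω) c).out
  have hr : ∀ (g : Γ) (c : Ω), r (g • c) = r c := fun g c =>
    congrArg Quotient.out (Quotient.sound (s := MulAction.orbitRel Γ Ω) ⟨g, rfl⟩)
  have ht : ∀ c, ∃ t : Γ, t • r c = c := fun c =>
    (MulAction.orbitRel Γ Ω).symm (Quotient.mk_out (s := MulAction.orbitRel Γ Ω) c)
  choose t ht using ht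
  refine ⟨fun c => f (t c) • y (r c), fun g c => ?_⟩
  -- Both `t (g • c)` and `g * t c` carry the representative to `g • c`, so they differ by an
  -- element of its stabilizer, whose image under f fixes the chosen point.
  have hs : (t (g • c))⁻¹ * (g * t c) ∈ MulAction.stabilizer Γ (r c) := by
    rw [MulAction.mem_stabilizer_iff, mul_smul, mul_smul, ht, inv_smul_eq_iff, ← hr g c, ht]
  have h := hy _ _ hs
  rw [map_mul, map_mul, map_inv, mul_smul, mul_smul, inv_smul_eq_iff] at h
  simp only [hr]
  exact h.symm

end Existence

/-! ### Independence of the choice of `h` -/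

section Invariance

variable {M E Γ : Type} [TopologicalSpace M] [TopologicalSpace E] [Group Γ] [MulAction Γ E]
  {p : E → M}

/-- `μ(β_h(f))` does not depend on `h`. -/
lemma mu_beta_eq {hp : IsQuotientCoveringMap p Γ} {B : Set M} {n : ℕ} [NeZero n] (hn : 2 ≤ n)
    {f : Γ →* IsomPlus n} (h h' : CuspMap hp B f) (ω : relSingularHomology ℤ B n) :
    mu ℤ (IsomPlus n) n hn (beta hn h ω) = mu ℤ (IsomPlus n) n hn (beta hn h' ω) := by
  by_cases hB : Nonempty (Components hp B)
  · have e : ∀ h : CuspMap hp B f, beta hn h ω =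
        groupHomology.map f (jMap ℤ f h.toFun h.map_smul') (n - 1)
          (relClassifying ℤ hp B n hn ω) := fun h => dif_pos hB
    rw [e, e]
    exact congr($(map_jMap_comp_mu_eq ℤ f h.map_smul' h'.map_smul' n hn)
      (relClassifying ℤ hp B n hn ω))
  -- Without cusps the class comes from H_n(Γ) by way of the connecting homomorphism, and the
  -- right-hand side does not contain `h`.
  · have e : ∀ h : CuspMap hp B f, beta hn h ω =
        groupHomology.δ (augSeq_shortExact ℤ (IsomPlus n) (HypBoundary n)) n (n - 1) (by omega)
          (groupHomology.map f (trivialMap ℤ f) n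
            (absClassifying ℤ hp (not_nonempty_iff.1 hB) n ω)) := fun h => dif_neg hB
    rw [e, e]

end Invariance

end HypBloch

end

theorem mainTheorem8 (n : ℕ) [NeZero n] (hn : 2 ≤ n)
    (M₀ : Type) [TopologicalSpace M₀] [T2Space M₀] [CompactSpace M₀]
    [ChartedSpace (EuclideanHalfSpace n) M₀]
    (E : Type) [TopologicalSpace E] (Γ : Type) [Group Γ] [MulAction Γ E] (p : E → M₀)
    (hp : IsQuotientCoveringMap p Γ) [ContractibleSpace E]
    (hcomp : ∀ c : Components hp (manifoldBoundary n M₀),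
      ContractibleSpace (componentOf hp (manifoldBoundary n M₀) ⁻¹' {c}))
    (ω : relSingularHomology ℤ (manifoldBoundary n M₀) n)
    (hω : IsFundamentalClass ℤ ω)
    (f : Γ →* IsomPlus n)
    (hf : ∀ c : Components hp (manifoldBoundary n M₀),
      ∃ x : HypBoundary n, ∀ g ∈ MulAction.stabilizer Γ c, f g • x = x) :
    Nonempty (CuspMap hp (manifoldBoundary n M₀) f) ∧
      ∃! b : P n, ∀ h : CuspMap hp (manifoldBoundary n M₀) f,
        mu ℤ (IsomPlus n) n hn (beta hn h ω) = b := by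
  obtain ⟨h, hh⟩ := exists_equivariant f hf
  -- The witness is the value at the map just constructed. Uniqueness also rests on that map: if
  -- there were none, every element of `P n` would qualify vacuously.
  exact ⟨⟨⟨h, hh⟩⟩, _, fun h' => mu_beta_eq hn h' ⟨h, hh⟩ ω, fun _ hb => (hb _).symm⟩
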